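/- Let $d,\eta>0$, $\xi\in\mathbb R$ with $\sqrt{\xi^2+\eta^2}\le d$, and $\beta>0$. Put $\hat{\mathbf e}_1=(d,0)$, $\hat{\mathbf e}_2=(\xi,\eta)$, $\mathbf l_{mn}=m\hat{\mathbf e}_1+n\hat{\mathbf e}_2$, let $\mathcal C=\{a\hat{\mathbf e}_1+b\hat{\mathbf e}_2 : a,b\in[-\tfrac12,\tfrac12]\}$ be the unit cell and $A=d/\eta$ its aspect ratio. Let $G(\mathbf t,\mathbf s)=\frac1{2\pi}K_0(\beta\|\mathbf t-\mathbf s\|)$ be the Green's function of the modified Helmholtz equation in the plane, where $K_0(r)=\int_0^\infty e^{-r\cosh u}\,du$ is the modified Bessel function of the second kind. Let $\mathbf t_l=(x_l,y_l)$, $l=1,\dots,N_T$, and $\mathbf s_j=(x'_j,y'_j)$, $j=1,\dots,N_S$, be targets and sources in $\mathcal C$, and let $\mathbf P^{south}_2$ be the $N_T\times N_S$ matrix $$\mathbf P_2^{south}(l,j)=\sum_{n\le -2}\ \sum_{m\in\mathbb Z}G(\mathbf t_l,\mathbf s_j+\mathbf l_{mn}).$$ For $m\in\mathbb Z$ let $$\alpha_m=\frac{2\pi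 m}{d},\qquad \chi_m=\sqrt{\alpha_m^2+\beta^2},\qquad Q_m=\chi_m\eta-i\alpha_m\xi,$$ and for an integer $M\ge 0$ let $\mathbf L\in\mathbb C^{N_T\times(2M+1)}$, $\mathbf R\in\mathbb C^{(2M+1)\times N_S}$ and the diagonal matrix $\mathbf D\in\mathbb C^{(2M+1)\times(2M+1)}$, with modes $m=-M,\dots,M$, be given by $$\mathbf L(l,m)=e^{-\chi_m y_l}e^{i\alpha_m x_l},\qquad \mathbf R(m,j)=e^{\chi_m y'_j}e^{-i\alpha_m x'_j},\qquad \mathbf D(m,m)=\frac{1}{2d\,\chi_m}\,\frac{e^{-2Q_m}}{1-e^{-Q_m}} .$$ Then the following hold. (i) The double series defining $\mathbf P_2^{south}(l,j)$ converges absolutely for all $l,j$. (ii) For every integer $M\ge0$ and all $l,j$, $$\bigl|\mathbf P_2^{south}(l,j)-(\mathbf L\mathbf D\mathbf R)(l,j)\bigr|<\frac{1}{2\pi(M+1)}\,\frac{e^{-2\pi(M+1)\eta/d}}{\bigl(1-e^{-2\pi(M+1)\eta/d}\bigr)\bigl(1-e^{-2\pi\eta/d}\bigr)} .$$ (iii)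 Given a precision $0<\epsilon<1$, choose $$M=\left\lceil\frac{d}{2\pi\eta}\log\left(\frac{1}{1-e^{-2\pi\eta/d}}\,\frac1\epsilon\right)\right\rceil .$$ Then $\mathbf P_2^{south}=\mathbf L\mathbf D\mathbf R+O(\epsilon)$ entrywise, and $M=\frac{A}{2\pi}\bigl(\log A+\log(1/\epsilon)\bigr)+O(A)$. That is, there is an absolute constant $C$, independent of $d,\xi,\eta,\beta,\epsilon,N_T,N_S$ and of the points, with $$\bigl|\mathbf P_2^{south}(l,j)-(\mathbf L\mathbf D\mathbf R)(l,j)\bigr|\le C\epsilon\ \text{ for all } l,j,\qquad \Bigl|M-\frac{A}{2\pi}\bigl(\log A+\log(1/\epsilon)\bigr)\Bigr|\le C A .$$ -/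

import Mathlib

noncomputable section

namespace ModHelmholtz

/-- The plane `ℝ²` with its Euclidean norm; `p 0` and `p 1` are the coordinates `x` and `y`. -/
abbrev Plane : Type := EuclideanSpace ℝ (Fin 2)

/-- The modified Bessel function of the second kind of order zero on `r > 0`,
`K₀(r) = ∫₀^∞ exp (-r cosh u) du`. -/
def besselK0 (r : ℝ) : ℝ :=
  ∫ u in Set.Ioi (0 : ℝ), Real.exp (-r * Real.cosh u)

/-- The free-space Green's function `G(t, s) = K₀(β ‖t - s‖) / (2π)`. -/
def green (β : ℝ) (t s : Plane) : ℝ :=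
  1 / (2 * Real.pi) * besselK0 (β * ‖t - s‖)

/-- The first lattice vector `e₁ = (d, 0)`. -/
def latE1 (d : ℝ) : Plane := !₂[d, 0]

/-- The second lattice vector `e₂ = (ξ, η)`. -/
def latE2 (ξ η : ℝ) : Plane := !₂[ξ, η]

/-- The lattice vector `l_{mn} = m e₁ + n e₂`. -/
def latVec (d ξ η : ℝ) (m n : ℤ) : Plane :=
  (m : ℝ) • latE1 d + (n : ℝ) • latE2 ξ η

/-- The closed unit cell, a parallelogram centered at the origin. -/
def unitCell (d ξ η : ℝ) : Set Plane :=
  {p | ∃ a ∈ Set.Icc (-(1 / 2) : ℝ) (1 / 2), ∃ b ∈ Set.Icc (-(1 / 2) : ℝ) (1 / 2),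
    p = a • latE1 d + b • latE2 ξ η}

/-- Indices `(m, n)` of the image cells to the south: `m` arbitrary and `n ≤ -2`. -/
def southIndex : Set (ℤ × ℤ) := {p | p.2 ≤ -2}

/-- The term of the image sum that belongs to the cell `(m, n)`. -/
def imageTerm (d ξ η β : ℝ) (t s : Plane) (p : ℤ × ℤ) : ℝ :=
  green β t (s + latVec d ξ η p.1 p.2)

/-- The kernel of the south images, the sum of `G(t, s + l_{mn})` over all `m` and all `n ≤ -2`. -/
def kernelSouth (d ξ η β : ℝ) (t s : Plane) : ℝ :=
  ∑' p : southIndex, imageTerm d ξ η β t s p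

/-- The `N_T × N_S` matrix of the kernel of the south images. -/
def opSouth (d ξ η β : ℝ) {NT NS : ℕ} (t : Fin NT → Plane) (s : Fin NS → Plane) :
    Matrix (Fin NT) (Fin NS) ℂ :=
  Matrix.of fun l j => ((kernelSouth d ξ η β (t l) (s j) : ℝ) : ℂ)

/-- `α_m = 2πm/d`. -/
def alpha (d : ℝ) (m : ℤ) : ℝ := 2 * Real.pi * m / d

/-- `χ_m = √(α_m² + β²)`. -/
def chi (d β : ℝ) (m : ℤ) : ℝ := Real.sqrt (alpha d m ^ 2 + β ^ 2)

/-- `Q_m = χ_m η - i α_m ξ`. -/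
def bigQ (d ξ η β : ℝ) (m : ℤ) : ℂ :=
  (chi d β m : ℂ) * (η : ℂ) - Complex.I * (alpha d m : ℂ) * (ξ : ℂ)

/-- The mode `m ∈ {-M, …, M}` with position `k ∈ {0, …, 2M}`. -/
def mode (M : ℕ) (k : Fin (2 * M + 1)) : ℤ := ((k : ℕ) : ℤ) - (M : ℤ)

/-- `L(l, m) = exp (-χ_m y_l) exp (i α_m x_l)`. -/
def matL (d β : ℝ) (M : ℕ) {NT : ℕ} (t : Fin NT → Plane) :
    Matrix (Fin NT) (Fin (2 * M + 1)) ℂ :=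
  Matrix.of fun l k =>
    Complex.exp (-((chi d β (mode M k) : ℂ) * ((t l 1 : ℝ) : ℂ))) *
      Complex.exp (Complex.I * (alpha d (mode M k) : ℂ) * ((t l 0 : ℝ) : ℂ))

/-- `R(m, j) = exp (χ_m y'_j) exp (-i α_m x'_j)`. -/
def matR (d β : ℝ) (M : ℕ) {NS : ℕ} (s : Fin NS → Plane) :
    Matrix (Fin (2 * M + 1)) (Fin NS) ℂ :=
  Matrix.of fun k j =>
    Complex.exp ((chi d β (mode M k) : ℂ) * ((s j 1 : ℝ) : ℂ)) *
      Complex.exp (-(Complex.I * (alpha d (mode M k) : ℂ) * ((s j 0 : ℝ) : ℂ)))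

/-- The diagonal matrix with `D(m, m) = (1 / (2 d χ_m)) exp (-2 Q_m) / (1 - exp (-Q_m))`. -/
def matD (d ξ η β : ℝ) (M : ℕ) : Matrix (Fin (2 * M + 1)) (Fin (2 * M + 1)) ℂ :=
  Matrix.diagonal fun k =>
    1 / (2 * (d : ℂ) * (chi d β (mode M k) : ℂ)) *
      (Complex.exp (-2 * bigQ d ξ η β (mode M k)) /
        (1 - Complex.exp (-bigQ d ξ η β (mode M k))))

/-- The aspect ratio `A = d / η`. -/
def aspect (d η : ℝ) : ℝ := d / η

/-- The truncation order
`M = ⌈(d / (2πη)) log ((1 / (1 - exp (-2πη/d))) (1 / ε))⌉`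
(the argument of the ceiling is positive for `0 < ε < 1`). -/
def truncOrder (d η ε : ℝ) : ℕ :=
  ⌈d / (2 * Real.pi * η) *
    Real.log (1 / (1 - Real.exp (-(2 * Real.pi * η / d))) * (1 / ε))⌉₊

/-- The explicit bound for the tail `|m| > M` of the plane-wave series. -/
def tailBound (d η : ℝ) (M : ℕ) : ℝ :=
  1 / (2 * Real.pi * (M + 1)) *
    (Real.exp (-(2 * Real.pi * (M + 1) * η / d)) /
      ((1 - Real.exp (-(2 * Real.pi * (M + 1) * η / d))) *
        (1 - Real.exp (-(2 * Real.pi * η / d)))))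

end ModHelmholtz

end

/-!
The sum over one horizontal row of images is a periodic function of the horizontal offset `x`, so
it can be rewritten by Poisson summation. The Fourier transform needed is
`∫ e^{iax} e^{-y χ(a)} / χ(a) da = 2 K₀(β √(x² + y²))` with `χ(a) = √(a² + β²)` and `y > 0`
(`integral_waveDensity`). After the substitution `a = β sinh u` its left side is the integral of
`exp (-r cosh (u - i φ))` over the real line, where `r e^{iφ} = β (y + i x)`, and this does not
depend on `φ` for `|φ| < π / 2` (`hasDerivAt_integral_exp_cosh_shift`). Poisson summation
(`tsum_waveDensity`) then writes each row as a series of plane waves that decay away from the row.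

For targets and sources in the unit cell the vertical offset of the row `n = -(k + 2)` is at least
`(k + 1) η`. Hence the double series over rows and modes converges absolutely. As the image terms
are nonnegative, this gives the absolute convergence of the lattice sum; and summing the geometric
series in `k` first turns the lattice sum into a series over the modes `m`, whose partial sum over
`|m| ≤ M` is the entry of `L D R` (`hasSum_modeTerm`, `matL_mul_matD_mul_matR_apply`).

A mode `m ≠ 0` is at most `(2dχ_m)⁻¹ e^{-χ_m η} / (1 - e^{-χ_m η})`, and `χ_m > 2π|m|/d` because
`β > 0`. Comparing the remaining modes with a geometric series of ratio `q = e^{-2πη/d}` gives the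
strict tail bound (`norm_opSouth_sub_lt_tailBound`). The choice of the truncation order makes
`q ^ M ≤ (1 - q) ε`. Since `q (1 - q) ≤ 1 / 4`, the factor `1 - q ^ (M + 1)` is at least `3 / 4`,
and the tail is at most `ε`. The size of the truncation order follows from
`1 / 2 ≤ A (1 - e^{-2π/A}) ≤ 2π` for `A ≥ 1`.
-/

namespace ModHelmholtz

open MeasureTheory Filter Topology

/-! ### The Bessel integral and its contour shift -/

lemma one_add_sq_le_two_mul_cosh (u : ℝ) : 1 + u ^ 2 ≤ 2 * Real.cosh u := by
  have h1 : |u| / 2 ≤ Real.sinh (|u| / 2) := Real.self_le_sinh_iff.2 (by positivity)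
  have h2 : Real.cosh u = 1 + 2 * Real.sinh (|u| / 2) ^ 2 := by
    rw [← Real.cosh_abs, ← mul_div_cancel₀ |u| (two_ne_zero' ℝ), Real.cosh_two_mul, Real.cosh_sq]
    ring_nf
  have h3 : (|u| / 2) ^ 2 ≤ Real.sinh (|u| / 2) ^ 2 := by gcongr
  rw [div_pow, sq_abs] at h3
  linarith

lemma exp_neg_le_two_div_sq {z : ℝ} (hz : 0 < z) : Real.exp (-z) ≤ 2 / z ^ 2 := by
  have h := Real.quadratic_le_exp_of_nonneg hz.le
  rw [Real.exp_neg, inv_eq_one_div, div_le_div_iff₀ (Real.exp_pos z) (by positivity)]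
  linarith

lemma cosh_mul_exp_neg_le {c : ℝ} (hc : 0 < c) (u : ℝ) :
    Real.cosh u * Real.exp (-c * Real.cosh u) ≤ 4 / c ^ 2 * (1 + u ^ 2)⁻¹ := by
  have hp := Real.cosh_pos u
  have h := exp_neg_le_two_div_sq (mul_pos hc hp)
  have h1 := one_add_sq_le_two_mul_cosh u
  calc Real.cosh u * Real.exp (-c * Real.cosh u)
      ≤ Real.cosh u * (2 / (c * Real.cosh u) ^ 2) := by
        rw [neg_mul]; gcongr
    _ = 4 / c ^ 2 * (2 * Real.cosh u)⁻¹ := by field_simp; ring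
    _ ≤ 4 / c ^ 2 * (1 + u ^ 2)⁻¹ := by gcongr

lemma integrable_cosh_mul_exp_neg {c : ℝ} (hc : 0 < c) :
    Integrable fun u : ℝ => Real.cosh u * Real.exp (-c * Real.cosh u) := by
  refine (integrable_inv_one_add_sq.const_mul (4 / c ^ 2)).mono'
    (by fun_prop) (Eventually.of_forall fun u => ?_)
  rw [Real.norm_of_nonneg (by positivity)]
  exact cosh_mul_exp_neg_le hc u

lemma exp_neg_le_cosh_mul_exp_neg (c u : ℝ) :
    Real.exp (-c * Real.cosh u) ≤ Real.cosh u * Real.exp (-c * Real.cosh u) :=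
  le_mul_of_one_le_left (Real.exp_pos _).le (Real.one_le_cosh u)

lemma integrable_exp_neg_cosh {c : ℝ} (hc : 0 < c) :
    Integrable fun u : ℝ => Real.exp (-c * Real.cosh u) := by
  refine (integrable_cosh_mul_exp_neg hc).mono' (by fun_prop) (Eventually.of_forall fun u => ?_)
  rw [Real.norm_of_nonneg (by positivity)]
  exact exp_neg_le_cosh_mul_exp_neg c u

lemma two_mul_besselK0 (r : ℝ) :
    2 * besselK0 r = ∫ u : ℝ, Real.exp (-r * Real.cosh u) := by
  rw [besselK0, ← integral_comp_abs (f := fun u => Real.exp (-r * Real.cosh u))]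
  simp only [Real.cosh_abs]

lemma besselK0_nonneg (r : ℝ) : 0 ≤ besselK0 r :=
  integral_nonneg fun _ => (Real.exp_pos _).le

lemma besselK0_le {r : ℝ} (hr : 0 < r) : besselK0 r ≤ 2 * Real.pi / r ^ 2 := by
  have h : 2 * besselK0 r ≤ ∫ u : ℝ, 4 / r ^ 2 * (1 + u ^ 2)⁻¹ := by
    rw [two_mul_besselK0]
    exact integral_mono (integrable_exp_neg_cosh hr) (integrable_inv_one_add_sq.const_mul _)
      fun u => (exp_neg_le_cosh_mul_exp_neg r u).trans (cosh_mul_exp_neg_le hr u)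
  rw [integral_const_mul, integral_univ_inv_one_add_sq] at h
  have : 4 / r ^ 2 * Real.pi = 2 * (2 * Real.pi / r ^ 2) := by ring
  linarith

lemma cosh_sub_mul_I (u φ : ℝ) :
    Complex.cosh (u - φ * Complex.I) =
      ((Real.cosh u * Real.cos φ : ℝ) : ℂ) - ((Real.sinh u * Real.sin φ : ℝ) : ℂ) * Complex.I := by
  rw [Complex.cosh_sub, Complex.cosh_mul_I, Complex.sinh_mul_I]
  push_cast; ring

lemma sinh_sub_mul_I (u φ : ℝ) :
    Complex.sinh (u - φ * Complex.I) =
      ((Real.sinh u * Real.cos φ : ℝ) : ℂ) - ((Real.cosh u * Real.sin φ : ℝ) : ℂ) * Complex.I := by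
  rw [Complex.sinh_sub, Complex.cosh_mul_I, Complex.sinh_mul_I]
  push_cast; ring

lemma norm_exp_cosh_shift (r u φ : ℝ) :
    ‖Complex.exp (-r * Complex.cosh (u - φ * Complex.I))‖ =
      Real.exp (-(r * Real.cos φ) * Real.cosh u) := by
  rw [Complex.norm_exp, cosh_sub_mul_I]
  simp only [neg_mul, Complex.neg_re, Complex.mul_re, Complex.sub_re, Complex.sub_im,
    Complex.mul_im, Complex.ofReal_re, Complex.ofReal_im, Complex.I_re, Complex.I_im]
  ring_nf

lemma norm_sinh_shift_le (u φ : ℝ) :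
    ‖Complex.sinh (u - φ * Complex.I)‖ ≤ Real.cosh u := by
  rw [sinh_sub_mul_I, ← sq_le_sq₀ (norm_nonneg _) (Real.cosh_pos u).le, ← Complex.normSq_eq_norm_sq,
    Complex.normSq_apply]
  simp only [Complex.sub_re, Complex.sub_im, Complex.mul_re, Complex.mul_im, Complex.ofReal_re,
    Complex.ofReal_im, Complex.I_re, Complex.I_im]
  have h1 := Real.cosh_sq u
  have h2 := Real.sin_sq_add_cos_sq φ
  have h3 : Real.sinh u ^ 2 * Real.cos φ ^ 2 + Real.cosh u ^ 2 * Real.sin φ ^ 2 ≤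
      Real.cosh u ^ 2 := by nlinarith [sq_nonneg (Real.cos φ)]
  nlinarith

lemma integrable_exp_cosh_shift {r φ : ℝ} (hr : 0 < r) (hφ : 0 < Real.cos φ) :
    Integrable fun u : ℝ => Complex.exp (-r * Complex.cosh (u - φ * Complex.I)) := by
  refine (integrable_exp_neg_cosh (mul_pos hr hφ)).mono' (by fun_prop)
    (Eventually.of_forall fun u => ?_)
  rw [norm_exp_cosh_shift]

/-- For `|φ| < π / 2` the integral over the line shifted by `-iφ` is stationary in `φ`. The
derivative in `φ` of the shifted integrand is `-i` times its derivative in `u`, so it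
integrates to zero: this is Cauchy's theorem for the shifted contour. -/
lemma hasDerivAt_integral_exp_cosh_shift {r φ : ℝ} (hr : 0 < r)
    (hφ : φ ∈ Set.Ioo (-(Real.pi / 2)) (Real.pi / 2)) :
    HasDerivAt (fun φ : ℝ => ∫ u : ℝ, Complex.exp (-r * Complex.cosh (u - φ * Complex.I))) 0 φ := by
  obtain ⟨a, ha1, ha2⟩ := exists_between (abs_lt.2 hφ)
  have ha0 : 0 < a := (abs_nonneg _).trans_lt ha1
  have hca : 0 < Real.cos a := Real.cos_pos_of_mem_Ioo ⟨by linarith, ha2⟩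
  have hcφ : 0 < Real.cos φ := Real.cos_pos_of_mem_Ioo hφ
  -- the derivative of `u ↦ exp (-r cosh (u - i φ))`
  let D : ℝ → ℝ → ℂ := fun φ u =>
    Complex.exp (-r * Complex.cosh (u - φ * Complex.I)) *
      (-r * Complex.sinh (u - φ * Complex.I))
  have hbound : ∀ ψ ∈ Set.Ioo (-a) a, ∀ u, ‖D ψ u‖ ≤
      r * (Real.cosh u * Real.exp (-(r * Real.cos a) * Real.cosh u)) := by
    intro ψ hψ u
    have hc : Real.cos a ≤ Real.cos ψ := by
      rw [← Real.cos_abs ψ]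
      exact Real.cos_le_cos_of_nonneg_of_le_pi (abs_nonneg _) (by linarith [Real.pi_pos])
        (abs_lt.2 hψ).le
    simp only [D]
    rw [norm_mul, norm_exp_cosh_shift, norm_mul, norm_neg, Complex.norm_real,
      Real.norm_of_nonneg hr.le]
    calc _ ≤ Real.exp (-(r * Real.cos a) * Real.cosh u) * (r * Real.cosh u) := by
          gcongr
          exact norm_sinh_shift_le u ψ
      _ = _ := by ring
  have hint := (integrable_cosh_mul_exp_neg (mul_pos hr hca)).const_mul r
  have hφa : φ ∈ Set.Ioo (-a) a := abs_lt.1 ha1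
  have key := hasDerivAt_integral_of_dominated_loc_of_deriv_le (μ := volume)
    (F := fun (φ : ℝ) (u : ℝ) => Complex.exp (-r * Complex.cosh (u - φ * Complex.I)))
    (F' := fun φ u => -Complex.I * D φ u)
    (Ioo_mem_nhds hφa.1 hφa.2)
    (Eventually.of_forall fun ψ => by fun_prop)
    (integrable_exp_cosh_shift hr hcφ) (by fun_prop)
    (Eventually.of_forall fun u ψ hψ => by
      rw [norm_mul, norm_neg, Complex.norm_I, one_mul]
      exact hbound ψ hψ u)
    hint
    (Eventually.of_forall fun u ψ _ => by
      have h0 : HasDerivAt (fun ψ : ℝ => (u : ℂ) - ψ * Complex.I) (-(1 * Complex.I)) ψ :=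
        ((Complex.ofRealCLM.hasDerivAt (x := ψ)).mul_const Complex.I).const_sub (u : ℂ)
      have h1 := (((Complex.hasDerivAt_cosh _).comp _ h0).const_mul (-(r : ℂ))).cexp
      exact h1.congr_deriv (by simp only [D, Function.comp_apply]; ring))
  have hD : ∫ u : ℝ, D φ u = 0 := by
    refine integral_eq_zero_of_hasDerivAt_of_integrable
      (f := fun u : ℝ => Complex.exp (-r * Complex.cosh (u - φ * Complex.I))) (fun u => ?_) ?_
      (integrable_exp_cosh_shift hr hcφ)
    · have h0 : HasDerivAt (fun u : ℝ => (u : ℂ) - φ * Complex.I) 1 u :=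
        (Complex.ofRealCLM.hasDerivAt (x := u)).sub_const _
      have h1 := (((Complex.hasDerivAt_cosh _).comp _ h0).const_mul (-(r : ℂ))).cexp
      exact h1.congr_deriv (by simp only [D, Function.comp_apply]; ring)
    · exact hint.mono' (by fun_prop) (Eventually.of_forall fun u => hbound φ hφa u)
  have h2 := key.2
  rwa [integral_const_mul, hD, mul_zero] at h2

lemma integral_exp_cosh_shift {r φ : ℝ} (hr : 0 < r) (hφ : |φ| < Real.pi / 2) :
    ∫ u : ℝ, Complex.exp (-r * Complex.cosh (u - φ * Complex.I)) =
      ((2 * besselK0 r : ℝ) : ℂ) := by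
  have hd : ∀ x ∈ Set.Ioo (-(Real.pi / 2)) (Real.pi / 2), _ :=
    fun x hx => hasDerivAt_integral_exp_cosh_shift hr hx
  have h0 : (0 : ℝ) ∈ Set.Ioo (-(Real.pi / 2)) (Real.pi / 2) :=
    ⟨by linarith [Real.pi_pos], by linarith [Real.pi_pos]⟩
  have := isOpen_Ioo.is_const_of_deriv_eq_zero (convex_Ioo _ _).isPreconnected
    (fun x hx => (hd x hx).differentiableAt.differentiableWithinAt)
    (fun x hx => (hd x hx).deriv) (abs_lt.1 hφ) h0
  rw [this, two_mul_besselK0, ← integral_complex_ofReal]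
  simp

/-- The shift angle `φ` with `√(x² + y²) e^{iφ} = y + i x` turns the Bessel integral into a
Fourier integral. -/
lemma integral_exp_neg_cosh_add_sinh {β x y : ℝ} (hβ : 0 < β) (hy : 0 < y) :
    ∫ u : ℝ, Complex.exp (-((β * y * Real.cosh u : ℝ) : ℂ) +
      ((β * x * Real.sinh u : ℝ) : ℂ) * Complex.I) =
      ((2 * besselK0 (β * Real.sqrt (x ^ 2 + y ^ 2)) : ℝ) : ℂ) := by
  let z : ℂ := ⟨y, x⟩
  have hz : ‖z‖ = Real.sqrt (x ^ 2 + y ^ 2) := by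
    rw [Complex.norm_def, Complex.normSq_apply]
    congr 1
    simp only [z]; ring
  have hr : 0 < β * Real.sqrt (x ^ 2 + y ^ 2) := by positivity
  have hφ : |Complex.arg z| < Real.pi / 2 := Complex.abs_arg_lt_pi_div_two_iff.2 (Or.inl hy)
  rw [← integral_exp_cosh_shift hr hφ]
  congr 1
  ext u
  have hc : ‖z‖ * Real.cos (Complex.arg z) = y := Complex.norm_mul_cos_arg z
  have hs : ‖z‖ * Real.sin (Complex.arg z) = x := Complex.norm_mul_sin_arg z
  rw [cosh_sub_mul_I, ← hz]
  congr 1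
  rw [show β * y * Real.cosh u = β * (‖z‖ * Real.cos (Complex.arg z)) * Real.cosh u by rw [hc],
    show β * x * Real.sinh u = β * (‖z‖ * Real.sin (Complex.arg z)) * Real.sinh u by rw [hs]]
  push_cast; ring

/-! ### Poisson summation along a row of sources -/

/-- The plane-wave density `e^{iax} e^{-y χ} / χ` with `χ = √(a² + β²)`, as a function of a real
frequency `a`. -/
noncomputable def waveDensity (β x y a : ℝ) : ℂ :=
  Complex.exp (((a * x : ℝ) : ℂ) * Complex.I) *
    ((Real.exp (-(y * Real.sqrt (a ^ 2 + β ^ 2))) / Real.sqrt (a ^ 2 + β ^ 2) : ℝ) : ℂ)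

lemma sqrt_sq_add_sq_pos {β : ℝ} (hβ : 0 < β) (a : ℝ) : 0 < Real.sqrt (a ^ 2 + β ^ 2) :=
  Real.sqrt_pos.2 (by positivity)

lemma continuous_waveDensity {β : ℝ} (hβ : 0 < β) (x y : ℝ) : Continuous (waveDensity β x y) := by
  unfold waveDensity
  refine Continuous.mul (by fun_prop) (Complex.continuous_ofReal.comp ?_)
  exact Continuous.div (by fun_prop) (by fun_prop) fun a => (sqrt_sq_add_sq_pos hβ a).ne'

lemma norm_waveDensity {β : ℝ} (hβ : 0 < β) (x y a : ℝ) : ‖waveDensity β x y a‖ =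
    Real.exp (-(y * Real.sqrt (a ^ 2 + β ^ 2))) / Real.sqrt (a ^ 2 + β ^ 2) := by
  have := sqrt_sq_add_sq_pos hβ a
  rw [waveDensity, norm_mul, Complex.norm_exp_ofReal_mul_I, one_mul, Complex.norm_real,
    Real.norm_of_nonneg (by positivity)]

/-- The substitution `a = β sinh u` rationalizes the square root. -/
lemma integral_waveDensity {β y : ℝ} (hβ : 0 < β) (hy : 0 < y) (x : ℝ) :
    ∫ a : ℝ, waveDensity β x y a = ((2 * besselK0 (β * Real.sqrt (x ^ 2 + y ^ 2)) : ℝ) : ℂ) := by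
  have himg : (fun u : ℝ => β * Real.sinh u) '' Set.univ = Set.univ := by
    rw [Set.image_univ]
    refine Set.range_eq_univ.2 fun a => ?_
    obtain ⟨u, hu⟩ := Real.sinh_surjective (a / β)
    exact ⟨u, by rw [hu]; field_simp⟩
  have h := integral_image_eq_integral_abs_deriv_smul (s := Set.univ) (f' := fun u => β * Real.cosh u)
    MeasurableSet.univ (fun u _ => ((Real.hasDerivAt_sinh u).const_mul β).hasDerivWithinAt)
    (fun u _ v _ huv => Real.sinh_injective (mul_left_cancel₀ hβ.ne' huv)) (waveDensity β x y)
  rw [himg, setIntegral_univ, setIntegral_univ] at h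
  rw [h, ← integral_exp_neg_cosh_add_sinh hβ hy]
  congr 1
  ext u
  have hc := Real.cosh_pos u
  have hs : Real.sqrt ((β * Real.sinh u) ^ 2 + β ^ 2) = β * Real.cosh u := by
    rw [show (β * Real.sinh u) ^ 2 + β ^ 2 = (β * Real.cosh u) ^ 2 by
      rw [mul_pow, mul_pow, Real.cosh_sq]; ring]
    exact Real.sqrt_sq (by positivity)
  have hne : (β : ℂ) * (Real.cosh u : ℂ) ≠ 0 := by
    exact_mod_cast (mul_pos hβ hc).ne'
  rw [waveDensity, hs, abs_of_pos (mul_pos hβ hc), Complex.exp_add, Complex.real_smul,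
    ← Complex.ofReal_neg, ← Complex.ofReal_exp]
  rw [show β * y * Real.cosh u = y * (β * Real.cosh u) by ring,
    show β * x * Real.sinh u = β * Real.sinh u * x by ring, Complex.ofReal_div, Complex.ofReal_mul β]
  field_simp
  exact div_self hne

lemma summable_besselK0_row {d β y : ℝ} (hd : 0 < d) (hβ : 0 < β) (hy : 0 < y) (x : ℝ) :
    Summable fun n : ℤ => besselK0 (β * Real.sqrt ((x - n * d) ^ 2 + y ^ 2)) := by
  have hs := (Real.summable_one_div_int_pow (p := 2)).2 one_lt_two
  have hne : ∀ᶠ (n : ℤ) in cofinite, n ≠ 0 :=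
    Int.cofinite_eq ▸ (mem_sup.mpr ⟨eventually_ne_atBot 0, eventually_ne_atTop 0⟩)
  refine (hs.mul_left (2 * Real.pi * (2 * (1 + x ^ 2 / y ^ 2) / (β ^ 2 * d ^ 2)))
    ).of_norm_bounded_eventually ?_
  filter_upwards [hne] with n hn
  have hn2 : (0 : ℝ) < (n : ℝ) ^ 2 := by positivity
  rw [Real.norm_of_nonneg (besselK0_nonneg _)]
  refine (besselK0_le (by positivity)).trans ?_
  rw [mul_pow, Real.sq_sqrt (by positivity), mul_div_assoc, mul_assoc]
  -- `n² d² ≤ 2 (x - n d)² + 2 x²`, and `x²` is absorbed by means of `y > 0`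
  have hxy : x ^ 2 ≤ x ^ 2 / y ^ 2 * ((x - n * d) ^ 2 + y ^ 2) := by
    have : x ^ 2 = x ^ 2 / y ^ 2 * y ^ 2 := by field_simp
    nlinarith [mul_nonneg (div_nonneg (sq_nonneg x) (sq_nonneg y)) (sq_nonneg (x - n * d))]
  have key : (n : ℝ) ^ 2 * d ^ 2 ≤ 2 * (1 + x ^ 2 / y ^ 2) * ((x - n * d) ^ 2 + y ^ 2) := by
    nlinarith [sq_nonneg (n * d - 2 * x), sq_nonneg y]
  have hA : 0 < (x - n * d) ^ 2 + y ^ 2 := by positivity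
  have hinv : 1 / (β ^ 2 * ((x - n * d) ^ 2 + y ^ 2)) ≤
      2 * (1 + x ^ 2 / y ^ 2) / (β ^ 2 * d ^ 2) * (1 / (n : ℝ) ^ 2) := by
    rw [div_mul_div_comm, mul_one, div_le_div_iff₀ (by positivity) (by positivity)]
    calc 1 * (β ^ 2 * d ^ 2 * (n : ℝ) ^ 2) = β ^ 2 * ((n : ℝ) ^ 2 * d ^ 2) := by ring
      _ ≤ β ^ 2 * (2 * (1 + x ^ 2 / y ^ 2) * ((x - n * d) ^ 2 + y ^ 2)) := by gcongr
      _ = _ := by ring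
  calc 2 * (Real.pi / (β ^ 2 * ((x - n * d) ^ 2 + y ^ 2)))
      = 2 * Real.pi * (1 / (β ^ 2 * ((x - n * d) ^ 2 + y ^ 2))) := by ring
    _ ≤ 2 * Real.pi * (2 * (1 + x ^ 2 / y ^ 2) / (β ^ 2 * d ^ 2) * (1 / (n : ℝ) ^ 2)) := by gcongr
    _ = _ := by ring

open scoped FourierTransform in
/-- The field of a horizontal row of sources as a superposition of plane waves that decay in the
direction away from the row. -/
lemma tsum_waveDensity {d β y : ℝ} (hd : 0 < d) (hβ : 0 < β) (hy : 0 < y) (x : ℝ) :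
    ∑' m : ℤ, waveDensity β x y (alpha d m) =
      ∑' n : ℤ, ((d / Real.pi * besselK0 (β * Real.sqrt ((x - n * d) ^ 2 + y ^ 2)) : ℝ) : ℂ) := by
  have hπ := Real.pi_pos
  -- the phase `e^{iax}` is part of `f`, so Poisson summation is applied at the point `0`
  let f : ℝ → ℂ := fun v => waveDensity β x y (2 * Real.pi / d * v)
  have hF : ∀ n : ℤ, 𝓕 f n =
      ((d / Real.pi * besselK0 (β * Real.sqrt ((x - n * d) ^ 2 + y ^ 2)) : ℝ) : ℂ) := by
    intro n
    have h1 := Measure.integral_comp_mul_left (waveDensity β (x - n * d) y) (2 * Real.pi / d)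
    rw [integral_waveDensity hβ hy] at h1
    rw [Real.fourier_real_eq_integral_exp_smul]
    rw [show d / Real.pi * besselK0 (β * Real.sqrt ((x - n * d) ^ 2 + y ^ 2)) =
        |(2 * Real.pi / d)⁻¹| * (2 * besselK0 (β * Real.sqrt ((x - n * d) ^ 2 + y ^ 2))) by
      rw [abs_of_pos (by positivity)]; field_simp, Complex.ofReal_mul, ← Complex.real_smul, ← h1]
    congr 1
    ext v
    simp only [f, waveDensity, smul_eq_mul]
    rw [← mul_assoc, ← Complex.exp_add, ← add_mul, ← Complex.ofReal_add]
    congr 4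
    field_simp; ring
  have hdecay : f =O[cocompact ℝ] fun v => |v| ^ (-2 : ℝ) := by
    refine Asymptotics.IsBigO.of_bound (2 / (y * (2 * Real.pi / d)) ^ 2 / β) ?_
    have hne : ∀ᶠ v : ℝ in cocompact ℝ, v ≠ 0 := by
      rw [← Metric.cobounded_eq_cocompact]
      exact Bornology.eventually_ne_cobounded 0
    filter_upwards [hne] with v hv
    have hv0 : 0 < |v| := abs_pos.2 hv
    simp only [f]
    rw [norm_waveDensity hβ, Real.norm_of_nonneg (by positivity)]
    set a := 2 * Real.pi / d * v with ha
    have h1 : |a| ≤ Real.sqrt (a ^ 2 + β ^ 2) := Real.abs_le_sqrt (by nlinarith [sq_nonneg β])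
    have h2 : β ≤ Real.sqrt (a ^ 2 + β ^ 2) := Real.le_sqrt_of_sq_le (by nlinarith [sq_nonneg a])
    have h3 : |a| = 2 * Real.pi / d * |v| := by rw [ha, abs_mul, abs_of_pos (by positivity)]
    have h4 : 0 < |a| := by rw [h3]; positivity
    calc Real.exp (-(y * Real.sqrt (a ^ 2 + β ^ 2))) / Real.sqrt (a ^ 2 + β ^ 2)
        ≤ Real.exp (-(y * |a|)) / β := by gcongr
      _ ≤ 2 / (y * |a|) ^ 2 / β := by gcongr; exact exp_neg_le_two_div_sq (by positivity)
      _ = _ := by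
        rw [h3, Real.rpow_neg hv0.le, Real.rpow_two]
        field_simp
  have hcont : Continuous f := (continuous_waveDensity hβ x y).comp (by fun_prop)
  have hsum : Summable fun n : ℤ => 𝓕 f n := by
    simp_rw [hF]
    exact Complex.summable_ofReal.2 ((summable_besselK0_row hd hβ hy x).mul_left _)
  have hP := Real.tsum_eq_tsum_fourier_of_rpow_decay_of_summable hcont one_lt_two hdecay hsum 0
  simp only [zero_add, hF] at hP
  calc _ = ∑' m : ℤ, f m := by
        congr 1; ext m; simp only [f, alpha]; congr 1; ring
    _ = _ := by
        rw [hP]; congr 1; ext n; simp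

/-! ### The sum over all southern rows as a mode sum -/

lemma abs_snd_le_of_mem_unitCell {d ξ η : ℝ} (hη : 0 < η) {p : Plane}
    (hp : p ∈ unitCell d ξ η) : |p 1| ≤ η / 2 := by
  obtain ⟨a, -, b, hb, rfl⟩ := hp
  simp only [latE1, latE2, PiLp.add_apply, PiLp.smul_apply, smul_eq_mul]
  simp only [Matrix.cons_val_one, Matrix.cons_val_fin_one, mul_zero, zero_add]
  rw [abs_mul, abs_of_pos hη]
  have : |b| ≤ 1 / 2 := abs_le.2 hb
  nlinarith

/-- The southern image cells listed by rows: the pair `(k, m)` stands for the cell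
`(m, -(k + 2))`. -/
def southEquiv : ℕ × ℤ ≃ southIndex where
  toFun q := ⟨(q.2, -((q.1 : ℤ) + 2)), by show -((q.1 : ℤ) + 2) ≤ -2; omega⟩
  invFun p := ((-p.1.2 - 2).toNat, p.1.1)
  left_inv q := by
    ext
    · simp
    · rfl
  right_inv p := by
    have hp : p.1.2 ≤ -2 := p.2
    ext
    · rfl
    · simp only; omega

lemma imageTerm_southEquiv (d ξ η β : ℝ) (t s : Plane) (k : ℕ) (m : ℤ) :
    imageTerm d ξ η β t s (southEquiv (k, m)) = 1 / (2 * Real.pi) *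
      besselK0 (β * Real.sqrt ((t 0 - s 0 + (k + 2) * ξ - m * d) ^ 2 +
        (t 1 - s 1 + (k + 2) * η) ^ 2)) := by
  rw [imageTerm, green, EuclideanSpace.norm_eq, Fin.sum_univ_two]
  simp only [southEquiv, Equiv.coe_fn_mk, latVec, latE1, latE2, PiLp.sub_apply, PiLp.add_apply,
    PiLp.smul_apply, smul_eq_mul, Matrix.cons_val_zero, Matrix.cons_val_one,
    Matrix.cons_val_fin_one, Real.norm_eq_abs, sq_abs]
  push_cast
  ring_nf

/-- The contribution of the mode `m` to the field of the row `n = -(k + 2)`. -/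
noncomputable def rowModeTerm (d ξ η β : ℝ) (t s : Plane) (q : ℕ × ℤ) : ℂ :=
  1 / (2 * (d : ℂ)) * waveDensity β (t 0 - s 0 + (q.1 + 2) * ξ) (t 1 - s 1 + (q.1 + 2) * η)
    (alpha d q.2)

/-- The contribution of the mode `m` to the field of all southern rows; this is the entry of
the rank-one product belonging to one diagonal entry of `matD`. -/
noncomputable def modeTerm (d ξ η β : ℝ) (t s : Plane) (m : ℤ) : ℂ :=
  Complex.exp (-((chi d β m : ℂ) * ((t 1 : ℝ) : ℂ))) *
      Complex.exp (Complex.I * (alpha d m : ℂ) * ((t 0 : ℝ) : ℂ)) *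
    (1 / (2 * (d : ℂ) * (chi d β m : ℂ)) *
      (Complex.exp (-2 * bigQ d ξ η β m) / (1 - Complex.exp (-bigQ d ξ η β m)))) *
    (Complex.exp ((chi d β m : ℂ) * ((s 1 : ℝ) : ℂ)) *
      Complex.exp (-(Complex.I * (alpha d m : ℂ) * ((s 0 : ℝ) : ℂ))))

lemma chi_pos {β : ℝ} (hβ : 0 < β) (d : ℝ) (m : ℤ) : 0 < chi d β m :=
  sqrt_sq_add_sq_pos hβ _

lemma le_chi {β : ℝ} (d : ℝ) (m : ℤ) : β ≤ chi d β m :=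
  Real.le_sqrt_of_sq_le (by nlinarith [sq_nonneg (alpha d m)])

lemma abs_alpha_lt_chi {β : ℝ} (hβ : 0 < β) (d : ℝ) (m : ℤ) : |alpha d m| < chi d β m := by
  rw [chi, ← Real.sqrt_sq_eq_abs]
  exact Real.sqrt_lt_sqrt (sq_nonneg _) (by nlinarith)

lemma norm_rowModeTerm {d β : ℝ} (hd : 0 < d) (hβ : 0 < β) (ξ η : ℝ) (t s : Plane) (k : ℕ)
    (m : ℤ) : ‖rowModeTerm d ξ η β t s (k, m)‖ = 1 / (2 * d) *
      (Real.exp (-((t 1 - s 1 + (k + 2) * η) * chi d β m)) / chi d β m) := by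
  have : (1 / (2 * (d : ℂ))) = ((1 / (2 * d) : ℝ) : ℂ) := by push_cast; ring
  rw [rowModeTerm, norm_mul, norm_waveDensity hβ, this, Complex.norm_real,
    Real.norm_of_nonneg (by positivity), chi]

lemma norm_exp_neg_bigQ (d ξ η β : ℝ) (m : ℤ) :
    ‖Complex.exp (-bigQ d ξ η β m)‖ = Real.exp (-(chi d β m * η)) := by
  rw [Complex.norm_exp, bigQ]
  simp

lemma norm_exp_neg_bigQ_lt_one {η β : ℝ} (hη : 0 < η) (hβ : 0 < β) (d ξ : ℝ) (m : ℤ) :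
    ‖Complex.exp (-bigQ d ξ η β m)‖ < 1 := by
  rw [norm_exp_neg_bigQ, Real.exp_lt_one_iff, neg_lt_zero]
  exact mul_pos (chi_pos hβ d m) hη

lemma hasSum_rowModeTerm {d η β : ℝ} (hη : 0 < η) (hβ : 0 < β) (ξ : ℝ)
    (t s : Plane) (m : ℤ) :
    HasSum (fun k : ℕ => rowModeTerm d ξ η β t s (k, m)) (modeTerm d ξ η β t s m) := by
  have h := (hasSum_geometric_of_norm_lt_one (norm_exp_neg_bigQ_lt_one hη hβ d ξ m)).mul_left
    (Complex.exp (-((chi d β m : ℂ) * ((t 1 : ℝ) : ℂ))) *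
      Complex.exp (Complex.I * (alpha d m : ℂ) * ((t 0 : ℝ) : ℂ)) *
    (1 / (2 * (d : ℂ) * (chi d β m : ℂ)) * Complex.exp (-2 * bigQ d ξ η β m)) *
    (Complex.exp ((chi d β m : ℂ) * ((s 1 : ℝ) : ℂ)) *
      Complex.exp (-(Complex.I * (alpha d m : ℂ) * ((s 0 : ℝ) : ℂ)))))
  convert! h using 1
  · ext k
    rw [rowModeTerm, waveDensity, ← Complex.exp_nat_mul]
    simp only
    rw [← chi, Complex.ofReal_div, Complex.ofReal_exp]
    have e : Complex.exp (-((chi d β m : ℂ) * ((t 1 : ℝ) : ℂ))) *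
        Complex.exp (Complex.I * (alpha d m : ℂ) * ((t 0 : ℝ) : ℂ)) *
        Complex.exp (-2 * bigQ d ξ η β m) *
        (Complex.exp ((chi d β m : ℂ) * ((s 1 : ℝ) : ℂ)) *
        Complex.exp (-(Complex.I * (alpha d m : ℂ) * ((s 0 : ℝ) : ℂ)))) *
        Complex.exp (k * -bigQ d ξ η β m) =
        Complex.exp (((alpha d m * (t 0 - s 0 + (k + 2) * ξ) : ℝ) : ℂ) * Complex.I) *
        Complex.exp ((-((t 1 - s 1 + (k + 2) * η) * chi d β m) : ℝ) : ℂ) := by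
      simp only [← Complex.exp_add]
      congr 1
      rw [bigQ]
      push_cast; ring
    rw [mul_div_assoc', ← e]
    ring
  · rw [modeTerm]
    ring

lemma summable_exp_neg_abs_int {c : ℝ} (hc : 0 < c) :
    Summable fun m : ℤ => Real.exp (-(c * |(m : ℝ)|)) := by
  have h : Summable fun n : ℕ => Real.exp (-(c * n)) := by
    have := summable_geometric_of_lt_one (Real.exp_pos (-c)).le
      (Real.exp_lt_one_iff.2 (neg_lt_zero.2 hc))
    refine this.congr fun n => ?_
    rw [← Real.exp_nat_mul]; ring_nf
  refine Summable.of_nat_of_neg ?_ ?_ <;> simpa using h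

lemma summable_rowModeTerm {d η β : ℝ} (hd : 0 < d) (hη : 0 < η) (hβ : 0 < β) (ξ : ℝ)
    {t s : Plane} (hts : |t 1 - s 1| ≤ η) : Summable (rowModeTerm d ξ η β t s) := by
  have h1 : Summable fun k : ℕ => Real.exp (-(β * η)) ^ k :=
    summable_geometric_of_lt_one (Real.exp_pos _).le
      (Real.exp_lt_one_iff.2 (neg_lt_zero.2 (mul_pos hβ hη)))
  have h2 : Summable fun m : ℤ => Real.exp (-(2 * Real.pi / d * η * |(m : ℝ)|)) :=
    summable_exp_neg_abs_int (by positivity)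
  have h3 := (h1.mul_of_nonneg h2 (fun _ => by positivity) (fun _ => by positivity)).mul_left
    (1 / (2 * d) * (1 / β))
  refine h3.of_norm_bounded fun ⟨k, m⟩ => ?_
  have hχ := chi_pos hβ d m
  rw [norm_rowModeTerm hd hβ, mul_assoc, ← Real.exp_nat_mul, ← Real.exp_add,
    one_div_mul_eq_div β]
  have hα : |alpha d m| = 2 * Real.pi / d * |(m : ℝ)| := by
    rw [alpha, mul_div_right_comm, abs_mul, abs_of_pos (by positivity)]
  gcongr
  · -- of the `k + 1` copies of `χ`, one gives decay in `m` through `|α|`, the others decay in `k`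
    have h4 : (k + 1 : ℝ) * η ≤ t 1 - s 1 + (k + 2) * η := by linarith [(abs_le.1 hts).1]
    have h5 : k * β + |alpha d m| ≤ (k + 1) * chi d β m := by
      nlinarith [mul_le_mul_of_nonneg_left (le_chi (β := β) d m) (Nat.cast_nonneg (α := ℝ) k),
        (abs_alpha_lt_chi hβ d m).le]
    rw [hα] at h5
    nlinarith [mul_le_mul_of_nonneg_right h4 hχ.le, mul_le_mul_of_nonneg_right h5 hη.le]
  · exact le_chi d m

lemma tsum_rowModeTerm_row {d η β : ℝ} (hd : 0 < d) (hη : 0 < η) (hβ : 0 < β) (ξ : ℝ)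
    {t s : Plane} (hts : |t 1 - s 1| ≤ η) (k : ℕ) :
    ∑' m : ℤ, rowModeTerm d ξ η β t s (k, m) =
      ((∑' m : ℤ, imageTerm d ξ η β t s (southEquiv (k, m)) : ℝ) : ℂ) := by
  have hy : 0 < t 1 - s 1 + (k + 2) * η := by
    nlinarith [(abs_le.1 hts).1, mul_nonneg (Nat.cast_nonneg (α := ℝ) k) hη.le]
  simp only [rowModeTerm]
  rw [tsum_mul_left, tsum_waveDensity hd hβ hy, ← tsum_mul_left, Complex.ofReal_tsum]
  congr 1
  ext m
  rw [imageTerm_southEquiv]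
  have : (d : ℂ) ≠ 0 := by exact_mod_cast hd.ne'
  push_cast
  field_simp

lemma summable_imageTerm_southEquiv {d η β : ℝ} (hd : 0 < d) (hη : 0 < η) (hβ : 0 < β) (ξ : ℝ)
    {t s : Plane} (hts : |t 1 - s 1| ≤ η) :
    Summable fun q : ℕ × ℤ => imageTerm d ξ η β t s (southEquiv q) := by
  refine (summable_prod_of_nonneg fun q => ?_).2 ⟨fun k => ?_, ?_⟩
  · exact mul_nonneg (by positivity) (besselK0_nonneg _)
  · have hy : 0 < t 1 - s 1 + (k + 2) * η := by
      nlinarith [(abs_le.1 hts).1, mul_nonneg (Nat.cast_nonneg (α := ℝ) k) hη.le]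
    simp only [imageTerm_southEquiv]
    exact (summable_besselK0_row hd hβ hy _).mul_left _
  · rw [← Complex.summable_ofReal]
    simp only [← tsum_rowModeTerm_row hd hη hβ ξ hts]
    exact (summable_rowModeTerm hd hη hβ ξ hts).prod

lemma summable_imageTerm {d η β : ℝ} (hd : 0 < d) (hη : 0 < η) (hβ : 0 < β) (ξ : ℝ)
    {t s : Plane} (hts : |t 1 - s 1| ≤ η) :
    Summable fun p : southIndex => imageTerm d ξ η β t s p :=
  southEquiv.summable_iff.1 (summable_imageTerm_southEquiv hd hη hβ ξ hts)

/-- Exchanging the sum over rows with the sum over modes turns the lattice sum into a series of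
modes. -/
lemma hasSum_modeTerm {d η β : ℝ} (hd : 0 < d) (hη : 0 < η) (hβ : 0 < β) (ξ : ℝ)
    {t s : Plane} (hts : |t 1 - s 1| ≤ η) :
    HasSum (modeTerm d ξ η β t s) ((kernelSouth d ξ η β t s : ℝ) : ℂ) := by
  have hS := summable_rowModeTerm hd hη hβ ξ hts
  have hswap : Summable fun q : ℤ × ℕ => rowModeTerm d ξ η β t s (q.2, q.1) :=
    (Equiv.prodComm ℤ ℕ).summable_iff.2 hS
  have hmode : Summable (modeTerm d ξ η β t s) :=
    hswap.prod.congr fun m => (hasSum_rowModeTerm hη hβ ξ t s m).tsum_eq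
  have hK : ((kernelSouth d ξ η β t s : ℝ) : ℂ) = ∑' m : ℤ, modeTerm d ξ η β t s m := by
    rw [kernelSouth, ← southEquiv.tsum_eq,
      (summable_imageTerm_southEquiv hd hη hβ ξ hts).tsum_prod, Complex.ofReal_tsum]
    simp only [← tsum_rowModeTerm_row hd hη hβ ξ hts]
    rw [Summable.tsum_comm (f := fun (m : ℤ) (k : ℕ) => rowModeTerm d ξ η β t s (k, m)) hswap]
    exact tsum_congr fun m => (hasSum_rowModeTerm hη hβ ξ t s m).tsum_eq
  rw [hK]
  exact hmode.hasSum

/-! ### Truncation of the mode series -/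

lemma sum_mode_add (f : ℤ → ℂ) (M : ℕ) :
    ∑ k : Fin (2 * M + 1), f (mode M k) + f 0 =
      ∑ i ∈ Finset.range (M + 1), (f (i : ℤ) + f (-(i : ℤ))) := by
  simp only [mode]
  rw [Fin.sum_univ_eq_sum_range (fun k : ℕ => f ((k : ℤ) - (M : ℤ))) (2 * M + 1)]
  induction M with
  | zero => simp
  | succ M ih =>
    rw [Finset.sum_range_succ _ (M + 1), ← ih, show 2 * (M + 1) + 1 = 2 * M + 1 + 1 + 1 by ring,
      Finset.sum_range_succ, Finset.sum_range_succ']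
    have h1 : ∀ k : ℕ, (((k + 1 : ℕ) : ℤ) - ((M + 1 : ℕ) : ℤ)) = (k : ℤ) - M := by
      intro k; push_cast; ring
    have h2 : (((2 * M + 1 + 1 : ℕ) : ℤ) - ((M + 1 : ℕ) : ℤ)) = ((M + 1 : ℕ) : ℤ) := by
      push_cast; ring
    rw [h2]
    simp only [h1, Nat.cast_zero, zero_sub]
    ring

lemma matL_mul_matD_mul_matR_apply (d ξ η β : ℝ) (M : ℕ) {NT NS : ℕ} (t : Fin NT → Plane)
    (s : Fin NS → Plane) (l : Fin NT) (j : Fin NS) :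
    (matL d β M t * matD d ξ η β M * matR d β M s) l j =
      ∑ k, modeTerm d ξ η β (t l) (s j) (mode M k) := by
  rw [Matrix.mul_apply]
  simp only [matL, matD, matR, Matrix.mul_diagonal, Matrix.of_apply, modeTerm]

/-- Each mode is bounded by the geometric series of its row contributions. -/
lemma norm_modeTerm_le {d η β : ℝ} (hd : 0 < d) (hη : 0 < η) (hβ : 0 < β) (ξ : ℝ)
    {t s : Plane} (hts : |t 1 - s 1| ≤ η) (m : ℤ) :
    ‖modeTerm d ξ η β t s m‖ ≤ 1 / (2 * d * chi d β m) *
      (Real.exp (-(chi d β m * η)) / (1 - Real.exp (-(chi d β m * η)))) := by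
  have hχ := chi_pos hβ d m
  obtain ⟨x, hx⟩ : ∃ x, x = Real.exp (-(chi d β m * η)) := ⟨_, rfl⟩
  rw [← hx]
  have hx0 : 0 < x := hx ▸ Real.exp_pos _
  have hx1 : x < 1 := hx ▸ Real.exp_lt_one_iff.2 (neg_lt_zero.2 (mul_pos hχ hη))
  have hg := (hasSum_geometric_of_lt_one hx0.le hx1).mul_left
    (1 / (2 * d * chi d β m) * x)
  rw [← (hasSum_rowModeTerm hη hβ ξ t s m).tsum_eq, div_eq_mul_inv x, ← mul_assoc]
  refine tsum_of_norm_bounded hg fun k => ?_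
  rw [norm_rowModeTerm hd hβ, mul_assoc, ← pow_succ', hx, ← Real.exp_nat_mul,
    show 1 / (2 * d) * (Real.exp (-((t 1 - s 1 + (k + 2) * η) * chi d β m)) / chi d β m) =
      1 / (2 * d * chi d β m) * Real.exp (-((t 1 - s 1 + (k + 2) * η) * chi d β m)) by
    field_simp]
  gcongr
  -- the row `n = -(k + 2)` lies at vertical distance at least `(k + 1) η`
  have h4 : (k + 1 : ℝ) * η ≤ t 1 - s 1 + (k + 2) * η := by linarith [(abs_le.1 hts).1]
  push_cast
  nlinarith [mul_le_mul_of_nonneg_right h4 hχ.le]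

lemma norm_modeTerm_lt {d η β : ℝ} (hd : 0 < d) (hη : 0 < η) (hβ : 0 < β) (ξ : ℝ)
    {t s : Plane} (hts : |t 1 - s 1| ≤ η) {m : ℤ} {N : ℕ} (hN : 0 < N) (hm : |(m : ℝ)| = N) :
    ‖modeTerm d ξ η β t s m‖ < 1 / (4 * Real.pi * N) *
      (Real.exp (-(2 * Real.pi * η / d)) ^ N / (1 - Real.exp (-(2 * Real.pi * η / d)) ^ N)) := by
  have hπ := Real.pi_pos
  have hN' : (0 : ℝ) < N := by exact_mod_cast hN
  have hα : |alpha d m| = 2 * Real.pi * N / d := by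
    rw [alpha, mul_div_right_comm, abs_mul, abs_of_pos (by positivity), hm]; ring
  have hlt := abs_alpha_lt_chi hβ d m
  rw [hα] at hlt
  have hχ := chi_pos hβ d m
  refine (norm_modeTerm_le hd hη hβ ξ hts m).trans_lt ?_
  have hx : Real.exp (-(chi d β m * η)) < Real.exp (-(2 * Real.pi * η / d)) ^ N := by
    rw [← Real.exp_nat_mul, Real.exp_lt_exp]
    have := mul_lt_mul_of_pos_right hlt hη
    have e : (N : ℝ) * -(2 * Real.pi * η / d) = -(2 * Real.pi * N / d * η) := by ring
    linarith
  have hq : Real.exp (-(2 * Real.pi * η / d)) ^ N < 1 :=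
    pow_lt_one₀ (Real.exp_pos _).le
      (Real.exp_lt_one_iff.2 (neg_lt_zero.2 (by positivity))) hN.ne'
  have hc : 1 / (2 * d * chi d β m) < 1 / (4 * Real.pi * N) := by
    apply one_div_lt_one_div_of_lt (by positivity)
    calc 4 * Real.pi * N = 2 * d * (2 * Real.pi * N / d) := by field_simp; ring
      _ < _ := by gcongr
  have hx0 := Real.exp_pos (-(chi d β m * η))
  have h1 : 0 < 1 - Real.exp (-(2 * Real.pi * η / d)) ^ N := by linarith
  apply mul_lt_mul'' hc _ (by positivity) (div_nonneg hx0.le (by linarith))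
  gcongr

/-- The modes `m` and `-m` are paired, and the pairs beyond `M` are compared with a geometric
series of ratio `e^{-2πη/d}`. -/
lemma norm_opSouth_sub_lt_tailBound {d η β : ℝ} (hd : 0 < d) (hη : 0 < η) (hβ : 0 < β) (ξ : ℝ)
    {NT NS : ℕ} (t : Fin NT → Plane) (s : Fin NS → Plane) (M : ℕ) (l : Fin NT) (j : Fin NS)
    (hts : |t l 1 - s j 1| ≤ η) :
    ‖(opSouth d ξ η β t s - matL d β M t * matD d ξ η β M * matR d β M s) l j‖ <
      tailBound d η M := by
  have hπ := Real.pi_pos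
  rw [Matrix.sub_apply, matL_mul_matD_mul_matR_apply]
  set f := modeTerm d ξ η β (t l) (s j) with hf
  have h := (hasSum_nat_add_iff' (M + 1)).2 (hasSum_modeTerm hd hη hβ ξ hts).nat_add_neg
  rw [← sum_mode_add, add_sub_add_right_eq_sub] at h
  have hop : opSouth d ξ η β t s l j = ((kernelSouth d ξ η β (t l) (s j) : ℝ) : ℂ) := rfl
  rw [hop, ← h.tsum_eq]
  set q := Real.exp (-(2 * Real.pi * η / d)) with hq
  have hq0 : 0 < q := Real.exp_pos _
  have hq1 : q < 1 := Real.exp_lt_one_iff.2 (neg_lt_zero.2 (by positivity))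
  have hqM : q ^ (M + 1) < 1 := pow_lt_one₀ hq0.le hq1 (by omega)
  have hg := (hasSum_geometric_of_lt_one hq0.le hq1).mul_left
    (1 / (2 * Real.pi * (M + 1)) * (q ^ (M + 1) / (1 - q ^ (M + 1))))
  have hexp : Real.exp (-(2 * Real.pi * (M + 1) * η / d)) = q ^ (M + 1) := by
    rw [hq, ← Real.exp_nat_mul]; congr 1; push_cast; ring
  have htail : tailBound d η M =
      1 / (2 * Real.pi * (M + 1)) * (q ^ (M + 1) / (1 - q ^ (M + 1))) * (1 - q)⁻¹ := by
    rw [tailBound, hexp, ← hq, ← div_div (q ^ (M + 1)), div_eq_mul_inv _ (1 - q), ← mul_assoc]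
  have hpair : ∀ i : ℕ, ‖f ((i + (M + 1) : ℕ) : ℤ) + f (-((i + (M + 1) : ℕ) : ℤ))‖ <
      1 / (2 * Real.pi * (M + 1)) * (q ^ (M + 1) / (1 - q ^ (M + 1))) * q ^ i := by
    intro i
    have hN : 0 < i + (M + 1) := by omega
    have h1 := norm_modeTerm_lt hd hη hβ ξ hts hN (m := ((i + (M + 1) : ℕ) : ℤ)) (by
      rw [Int.cast_natCast, Nat.abs_cast])
    have h2 := norm_modeTerm_lt hd hη hβ ξ hts hN (m := -((i + (M + 1) : ℕ) : ℤ)) (by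
      rw [Int.cast_neg, abs_neg, Int.cast_natCast, Nat.abs_cast])
    rw [← hq] at h1 h2
    have hpow : q ^ (i + (M + 1)) ≤ q ^ (M + 1) := pow_le_pow_of_le_one hq0.le hq1.le (by omega)
    have hden : 0 < 1 - q ^ (M + 1) := by linarith
    calc _ ≤ ‖f ((i + (M + 1) : ℕ) : ℤ)‖ + ‖f (-((i + (M + 1) : ℕ) : ℤ))‖ := norm_add_le _ _
      _ < 1 / (4 * Real.pi * (i + (M + 1) : ℕ)) *
            (q ^ (i + (M + 1)) / (1 - q ^ (i + (M + 1)))) +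
          1 / (4 * Real.pi * (i + (M + 1) : ℕ)) *
            (q ^ (i + (M + 1)) / (1 - q ^ (i + (M + 1)))) := add_lt_add h1 h2
      _ = 1 / (2 * Real.pi * (i + (M + 1) : ℕ)) *
            (q ^ (i + (M + 1)) / (1 - q ^ (i + (M + 1)))) := by
          rw [show 4 * Real.pi * ((i + (M + 1) : ℕ) : ℝ) =
            2 * (2 * Real.pi * ((i + (M + 1) : ℕ) : ℝ)) by ring, one_div, mul_inv]; ring
      _ ≤ 1 / (2 * Real.pi * (M + 1)) * (q ^ (i + (M + 1)) / (1 - q ^ (M + 1))) := by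
          have h3 : 0 < 1 - q ^ (i + (M + 1)) := by linarith
          have h4 : (M : ℝ) + 1 ≤ (i + (M + 1) : ℕ) := by
            push_cast; linarith [Nat.cast_nonneg (α := ℝ) i]
          gcongr
      _ = _ := by rw [pow_add]; ring
  have hsn := Summable.of_nonneg_of_le (fun _ => norm_nonneg _) (fun i => (hpair i).le) hg.summable
  rw [htail, ← hg.tsum_eq]
  exact (norm_tsum_le_tsum_norm hsn).trans_lt
    (hsn.tsum_lt_tsum (fun i => (hpair i).le) (hpair 0) hg.summable)

/-! ### The truncation order for a given precision -/

lemma truncOrder_arg_nonneg {d η ε : ℝ} (hd : 0 < d) (hη : 0 < η) (hε : 0 < ε) (hε1 : ε < 1) :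
    0 ≤ d / (2 * Real.pi * η) *
      Real.log (1 / (1 - Real.exp (-(2 * Real.pi * η / d))) * (1 / ε)) := by
  have hπ := Real.pi_pos
  have hq0 := Real.exp_pos (-(2 * Real.pi * η / d))
  have hq1 : Real.exp (-(2 * Real.pi * η / d)) < 1 :=
    Real.exp_lt_one_iff.2 (neg_lt_zero.2 (by positivity))
  refine mul_nonneg (by positivity) (Real.log_nonneg ?_)
  have h1 : 1 ≤ 1 / (1 - Real.exp (-(2 * Real.pi * η / d))) := by
    rw [le_div_iff₀ (by linarith)]; linarith
  have h2 : 1 ≤ 1 / ε := by rw [le_div_iff₀ hε]; linarith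
  nlinarith

/-- The truncation order is the least exponent that achieves `q ^ M ≤ (1 - q) ε` for
`q = e^{-2πη/d}`; the factor `1 - q` cancels the one in the denominator of the tail bound. -/
lemma exp_pow_truncOrder_le {d η ε : ℝ} (hd : 0 < d) (hη : 0 < η) (hε : 0 < ε) :
    Real.exp (-(2 * Real.pi * η / d)) ^ truncOrder d η ε ≤
      (1 - Real.exp (-(2 * Real.pi * η / d))) * ε := by
  have hπ := Real.pi_pos
  have hq1 : Real.exp (-(2 * Real.pi * η / d)) < 1 :=
    Real.exp_lt_one_iff.2 (neg_lt_zero.2 (by positivity))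
  have h := Nat.le_ceil (d / (2 * Real.pi * η) *
      Real.log (1 / (1 - Real.exp (-(2 * Real.pi * η / d))) * (1 / ε)))
  have hpos : 0 < (1 - Real.exp (-(2 * Real.pi * η / d))) * ε := mul_pos (by linarith) hε
  rw [← truncOrder, one_div_mul_one_div, one_div _, Real.log_inv, div_mul_eq_mul_div,
    div_le_iff₀ (by positivity), mul_neg] at h
  rw [← Real.exp_nat_mul, ← Real.le_log_iff_exp_le hpos]
  refine le_of_mul_le_mul_left ?_ hd
  calc d * (truncOrder d η ε * -(2 * Real.pi * η / d))
      = -(truncOrder d η ε * (2 * Real.pi * η)) := by field_simp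
    _ ≤ _ := by linarith

lemma tailBound_truncOrder_le {d η ε : ℝ} (hd : 0 < d) (hη : 0 < η) (hε : 0 < ε) (hε1 : ε < 1) :
    tailBound d η (truncOrder d η ε) ≤ ε := by
  have hπ := Real.pi_gt_three
  have hM := exp_pow_truncOrder_le hd hη hε
  set M := truncOrder d η ε
  set q := Real.exp (-(2 * Real.pi * η / d)) with hq
  have hq0 : 0 < q := Real.exp_pos _
  have hq1 : q < 1 := Real.exp_lt_one_iff.2 (neg_lt_zero.2 (by positivity))
  have hexp : Real.exp (-(2 * Real.pi * (M + 1) * η / d)) = q ^ (M + 1) := by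
    rw [hq, ← Real.exp_nat_mul]; congr 1; push_cast; ring
  rw [tailBound, hexp, ← hq]
  have h1 : q ^ (M + 1) ≤ q * ((1 - q) * ε) := by
    rw [pow_succ']; gcongr
  have h2 : q * (1 - q) ≤ 1 / 4 := by nlinarith [sq_nonneg (2 * q - 1)]
  have h3 : q ^ (M + 1) ≤ 1 / 4 := by
    have : q * (1 - q) * ε ≤ q * (1 - q) * 1 := by
      have : 0 ≤ q * (1 - q) := mul_nonneg hq0.le (by linarith)
      gcongr
    nlinarith
  have h4 : 0 < 1 - q := by linarith
  -- `4` is a convenient lower bound for `2π (M + 1)`; it covers the loss from `1 - q ^ (M + 1)`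
  have h5 : 1 / (2 * Real.pi * (M + 1)) ≤ 1 / 4 := by
    apply one_div_le_one_div_of_le (by norm_num)
    nlinarith [Nat.cast_nonneg (α := ℝ) M]
  calc 1 / (2 * Real.pi * (M + 1)) * (q ^ (M + 1) / ((1 - q ^ (M + 1)) * (1 - q)))
      ≤ 1 / 4 * (((1 - q) * ε) / ((3 / 4) * (1 - q))) := by
        have h6 : 3 / 4 ≤ 1 - q ^ (M + 1) := by linarith
        have h7 : q ^ (M + 1) ≤ (1 - q) * ε :=
          h1.trans (mul_le_of_le_one_left (by positivity) hq1.le)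
        have h8 : 0 < 1 - q ^ (M + 1) := by linarith
        gcongr
    _ = ε / 3 := by field_simp
    _ ≤ ε := by linarith

/-- With `A = d / η ≥ 1`, the number `A (1 - e^{-2π/A})` lies between two absolute positive
constants, so replacing `1 / (1 - e^{-2πη/d})` by `A` inside the logarithm costs `O(1)`. -/
lemma abs_log_one_div_sub_log_aspect_le {d η : ℝ} (hd : 0 < d) (hη : 0 < η) (hA : η ≤ d) :
    |Real.log (1 / (1 - Real.exp (-(2 * Real.pi * η / d)))) - Real.log (aspect d η)| ≤
      2 * Real.pi := by
  have hπ := Real.pi_gt_three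
  have hA0 : 0 < aspect d η := div_pos hd hη
  have hA1 : 1 ≤ aspect d η := (one_le_div hη).2 hA
  have hx : 2 * Real.pi * η / d = 2 * Real.pi / aspect d η := by rw [aspect]; field_simp
  rw [hx]
  generalize aspect d η = A at *
  set x := 2 * Real.pi / A with hxd
  have hx0 : 0 < x := by positivity
  have hAx : A * x = 2 * Real.pi := by rw [hxd]; field_simp
  have hq1 : Real.exp (-x) < 1 := Real.exp_lt_one_iff.2 (by linarith)
  have hw : 0 < 1 - Real.exp (-x) := by linarith
  rw [one_div, Real.log_inv, ← neg_add', abs_neg, ← Real.log_mul hw.ne' hA0.ne']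
  have hup : (1 - Real.exp (-x)) * A ≤ 2 * Real.pi := by
    nlinarith [Real.add_one_le_exp (-x)]
  -- `1 - e^{-x} ≥ x / (1 + x)`, and `x ≤ 2π`
  have hlow : 1 / 2 ≤ (1 - Real.exp (-x)) * A := by
    have h1 : Real.exp (-x) * (1 + x) ≤ 1 := by
      have := mul_le_mul_of_nonneg_left (Real.add_one_le_exp x) (Real.exp_pos (-x)).le
      rw [← Real.exp_add, neg_add_cancel, Real.exp_zero] at this
      linarith
    have h2 : x ≤ (1 - Real.exp (-x)) * (1 + x) := by linarith
    have h3 : A * x ≤ (1 - Real.exp (-x)) * (A + A * x) := by nlinarith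
    rw [hAx] at h3
    have h4 : (1 - Real.exp (-x)) * (A + 2 * Real.pi) ≤
        (1 - Real.exp (-x)) * (A + 2 * Real.pi * A) :=
      mul_le_mul_of_nonneg_left (by nlinarith) hw.le
    nlinarith
  rw [abs_le]
  constructor
  · have h1 : Real.log (1 / 2) ≤ Real.log ((1 - Real.exp (-x)) * A) :=
      Real.log_le_log (by norm_num) hlow
    have h2 : -1 ≤ Real.log (1 / 2) := by
      have := Real.one_sub_inv_le_log_of_pos (x := 1 / 2) (by norm_num)
      norm_num at this ⊢
      linarith
    linarith
  · exact (Real.log_le_self (by positivity)).trans hup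

lemma abs_truncOrder_sub_le {d η ε : ℝ} (hd : 0 < d) (hη : 0 < η) (hA : η ≤ d) (hε : 0 < ε)
    (hε1 : ε < 1) :
    |(truncOrder d η ε : ℝ) - aspect d η / (2 * Real.pi) *
      (Real.log (aspect d η) + Real.log (1 / ε))| ≤ 2 * aspect d η := by
  have hπ := Real.pi_pos
  have hA0 : 0 < aspect d η := div_pos hd hη
  have hA1 : 1 ≤ aspect d η := (one_le_div hη).2 hA
  have h0 := truncOrder_arg_nonneg hd hη hε hε1
  have hq1 : Real.exp (-(2 * Real.pi * η / d)) < 1 :=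
    Real.exp_lt_one_iff.2 (neg_lt_zero.2 (by positivity))
  have hc := abs_log_one_div_sub_log_aspect_le hd hη hA
  have e : d / (2 * Real.pi * η) = aspect d η / (2 * Real.pi) := by
    rw [aspect]; field_simp
  have h1 := Nat.le_ceil (d / (2 * Real.pi * η) *
      Real.log (1 / (1 - Real.exp (-(2 * Real.pi * η / d))) * (1 / ε)))
  have h2 := Nat.ceil_lt_add_one h0
  rw [← truncOrder, Real.log_mul (one_div_pos.2 (by linarith)).ne' (one_div_pos.2 hε).ne', e]
    at h1 h2
  set P := Real.log (1 / (1 - Real.exp (-(2 * Real.pi * η / d))))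
  set L := Real.log (aspect d η)
  have h3 : |aspect d η / (2 * Real.pi) * (P - L)| ≤ aspect d η := by
    rw [abs_mul, abs_of_pos (by positivity)]
    calc _ ≤ aspect d η / (2 * Real.pi) * (2 * Real.pi) := by gcongr
      _ = _ := by field_simp
  rw [abs_le] at h3 ⊢
  constructor <;> linarith [h3.1, h3.2]

end ModHelmholtz

theorem mainTheorem1 :
    ∃ C : ℝ, 0 < C ∧
      ∀ (d ξ η β : ℝ), 0 < d → 0 < η → Real.sqrt (ξ ^ 2 + η ^ 2) ≤ d → 0 < β →
      ∀ (NT NS : ℕ) (t : Fin NT → ModHelmholtz.Plane) (s : Fin NS → ModHelmholtz.Plane),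
        (∀ l, t l ∈ ModHelmholtz.unitCell d ξ η) →
        (∀ j, s j ∈ ModHelmholtz.unitCell d ξ η) →
        (∀ l j, Summable fun p : ModHelmholtz.southIndex =>
          ModHelmholtz.imageTerm d ξ η β (t l) (s j) p) ∧
        (∀ (M : ℕ) (l : Fin NT) (j : Fin NS),
          ‖(ModHelmholtz.opSouth d ξ η β t s -
              ModHelmholtz.matL d β M t * ModHelmholtz.matD d ξ η β M *
                ModHelmholtz.matR d β M s) l j‖ < ModHelmholtz.tailBound d η M) ∧
        (∀ (ε : ℝ), 0 < ε → ε < 1 → ∀ M : ℕ, M = ModHelmholtz.truncOrder d η ε →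
          (∀ (l : Fin NT) (j : Fin NS),
            ‖(ModHelmholtz.opSouth d ξ η β t s -
                ModHelmholtz.matL d β M t * ModHelmholtz.matD d ξ η β M *
                  ModHelmholtz.matR d β M s) l j‖ ≤ C * ε) ∧
          |(M : ℝ) - ModHelmholtz.aspect d η / (2 * Real.pi) *
              (Real.log (ModHelmholtz.aspect d η) + Real.log (1 / ε))| ≤
            C * ModHelmholtz.aspect d η) := by
  refine ⟨2, two_pos, ?_⟩
  intro d ξ η β hd hη hξη hβ NT NS t s ht hs
  have hts : ∀ l j, |t l 1 - s j 1| ≤ η := fun l j => by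
    have h1 := ModHelmholtz.abs_snd_le_of_mem_unitCell hη (ht l)
    have h2 := ModHelmholtz.abs_snd_le_of_mem_unitCell hη (hs j)
    linarith [abs_sub (t l 1) (s j 1)]
  have hA : η ≤ d := (Real.le_sqrt_of_sq_le (by nlinarith [sq_nonneg ξ])).trans hξη
  refine ⟨fun l j => ModHelmholtz.summable_imageTerm hd hη hβ ξ (hts l j),
    fun M l j => ModHelmholtz.norm_opSouth_sub_lt_tailBound hd hη hβ ξ t s M l j (hts l j), ?_⟩
  rintro ε hε hε1 M rfl
  refine ⟨fun l j => ?_, ModHelmholtz.abs_truncOrder_sub_le hd hη hA hε hε1⟩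
  have h := ModHelmholtz.norm_opSouth_sub_lt_tailBound hd hη hβ ξ t s
    (ModHelmholtz.truncOrder d η ε) l j (hts l j)
  linarith [ModHelmholtz.tailBound_truncOrder_le hd hη hε hε1]
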